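/- A (right) nearring is a set $N$ with a group operation $+$ and an associative operation $\circ$ satisfying $(f+g)\circ h = f\circ h + g\circ h$; a subnearring is an additive subgroup closed under $\circ$, and the subnearring generated by a subset is the smallest subnearring containing it. Consider the nearring $(\mathbb{Z}[x],+,\circ)$ of integer polynomials, where $\circ$ is composition, $(f\circ g)(x)=f(g(x))$. For $i\in\mathbb{N}_0$ let $s_3(i)$ denote the sum of the base-$3$ digits of $i$. **Theorem.** A polynomial $p=\sum_{i=0}^n c_i x^i\in\mathbb{Z}[x]$ (with $c_i=0$ for $i>n$) lies in the subnearring of $(\mathbb{Z}[x],+,\circ)$ generated by $\{x^3\}$ if and only if the following four conditions hold: 1. for all $i\in\mathbb{N}_0$ with $i\not\equiv 3 \pmod 6$, $c_i=0$; 2. for all $i\in\mathbb{N}_0$ with $i\equiv 3 \pmod 6$, $3^{(s_3(i)-1)/2}$ divides $c_i$ (here $i$ is odd, so $s_3(i)$ is odd and the exponent is a non-negative integer); 3. $2$ divides $\sum_{j} c_j$, the sum being over all $j\in\mathbb{N}_0$ with $j \bmod 24\in\{15,21\}$; 4. $2$ divides $\sum_{j} c_j$, the sum being over all $j\in\mathbb{N}_0$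 with $j\ne 3$ and $j \bmod 72\in\{3,33,45,51,57,63\}$. -/

import Mathlib

open Polynomial

/-- A (right) nearring structure on an additively written, not necessarily commutative group:
an associative operation `circ` satisfying the right distributive law. -/
class Nearring (N : Type*) [AddGroup N] where
  circ : N → N → N
  circ_assoc : ∀ a b c : N, circ (circ a b) c = circ a (circ b c)
  add_circ : ∀ a b c : N, circ (a + b) c = circ a c + circ b c

/-- A subnearring: an additive subgroup closed under the nearring multiplication. -/
structure Subnearring (N : Type*) [AddGroup N] [Nearring N] extends AddSubgroup N where
  circ_mem' : ∀ {a b : N}, a ∈ carrier → b ∈ carrier → Nearring.circ a b ∈ carrier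

instance Subnearring.instSetLike (N : Type*) [AddGroup N] [Nearring N] :
    SetLike (Subnearring N) N where
  coe S := S.carrier
  coe_injective := by
    rintro ⟨S, hS⟩ ⟨T, hT⟩ h
    obtain rfl : S = T := SetLike.coe_injective h
    rfl

/-- The subnearring generated by `F`: the intersection of all subnearrings containing `F`. -/
def Subnearring.closure {N : Type*} [AddGroup N] [Nearring N] (F : Set N) : Subnearring N where
  carrier := {n | ∀ S : Subnearring N, F ⊆ (S : Set N) → n ∈ S}
  zero_mem' := fun S _ => S.zero_mem'
  add_mem' := fun ha hb S hS => S.add_mem' (ha S hS) (hb S hS)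
  neg_mem' := fun ha S hS => S.neg_mem' (ha S hS)
  circ_mem' := fun ha hb S hS => S.circ_mem' (ha S hS) (hb S hS)

/-- Integer polynomials form a nearring under addition and composition `(f ∘ g)(x) = f (g x)`. -/
noncomputable instance Polynomial.instNearringInt : Nearring ℤ[X] where
  circ f g := f.comp g
  circ_assoc := fun f g h => Polynomial.comp_assoc f g h
  add_circ := fun _ _ _ => Polynomial.add_comp

/-- The digit sum `s_b(a)` of the number `a` in base `b`. -/
def digitSum (b a : ℕ) : ℕ := (Nat.digits b a).sum

/-! The generated subnearring is the smallest additive subgroup S containing `X ^ 3` and closed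
under cubing (`mem_closure_X_pow_three_iff`). Necessity: the four conditions define a cube closed
group. Condition 2 survives because cross terms of a cube carry a factor 3 and ternary digit sums
are subadditive; conditions 3 and 4 survive because modulo 2 both parity sums of p^3 equal (first
parity sum of p) · p(1) (`weightSum_cube`). Sufficiency: if p satisfies the conditions, then 3^k p ∈
S for some k (`paritySubgroup_le_threeSaturation`) and 2p ∈ S (`two_mul_mem_cubeClosure`), so p ∈ S.
For the first claim, divide freely by 3: with y = x^3, every odd power of y lies in the saturation
of S up to integer multiples of y^5 and y^11 (`pow_mem_adjoinPow_and_two_mul_pow_mem`). The two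
parity sums detect these multiples modulo 2, and 2y^5, 2y^11 are already in the saturation. -/

/-- An additive subgroup of a commutative ring is cube closed if it contains the cubes of its
elements. -/
def AddSubgroup.CubeClosed {R : Type*} [CommRing R] (S : AddSubgroup R) : Prop :=
  ∀ a ∈ S, a ^ 3 ∈ S

/-- The smallest cube closed additive subgroup containing `y`. -/
def cubeClosure {R : Type*} [CommRing R] (y : R) : AddSubgroup R :=
  sInf {S | y ∈ S ∧ S.CubeClosed}

/-! ### Cube closed subgroups and saturation at 3 -/

section CubeClosed

variable {R : Type*} [CommRing R]

theorem self_mem_cubeClosure (y : R) : y ∈ cubeClosure y :=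
  AddSubgroup.mem_sInf.2 fun _ hS => hS.1

theorem cubeClosure_cubeClosed (y : R) : (cubeClosure y).CubeClosed := fun a ha =>
  AddSubgroup.mem_sInf.2 fun S hS => hS.2 a (AddSubgroup.mem_sInf.1 ha S hS)

theorem cubeClosure_le {y : R} {S : AddSubgroup R} (hy : y ∈ S) (hS : S.CubeClosed) :
    cubeClosure y ≤ S :=
  sInf_le ⟨hy, hS⟩

namespace AddSubgroup.CubeClosed

variable {S : AddSubgroup R}

/-- Polarisation of the cube; `six_mul_mem` polarises once more. -/
theorem three_mul_mem (hS : S.CubeClosed) {a b : R} (ha : a ∈ S) (hb : b ∈ S) :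
    3 * (a ^ 2 * b + a * b ^ 2) ∈ S := by
  have h := S.sub_mem (S.sub_mem (hS _ (S.add_mem ha hb)) (hS _ ha)) (hS _ hb)
  convert h using 1
  ring

theorem six_mul_mem (hS : S.CubeClosed) {a b c : R} (ha : a ∈ S) (hb : b ∈ S) (hc : c ∈ S) :
    6 * (a * b * c) ∈ S := by
  have h := S.sub_mem (S.sub_mem (hS.three_mul_mem (S.add_mem ha hb) hc)
    (hS.three_mul_mem ha hc)) (hS.three_mul_mem hb hc)
  convert h using 1
  ring

end AddSubgroup.CubeClosed

/-- The elements that some power of `3` multiplies into `S`. -/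
def AddSubgroup.threeSaturation (S : AddSubgroup R) : AddSubgroup R where
  carrier := {f | ∃ k : ℕ, 3 ^ k * f ∈ S}
  zero_mem' := ⟨0, by simp⟩
  add_mem' := by
    rintro a b ⟨k, hk⟩ ⟨l, hl⟩
    refine ⟨k + l, ?_⟩
    have h := S.add_mem (S.nsmul_mem hk (3 ^ l)) (S.nsmul_mem hl (3 ^ k))
    convert h using 1
    simp only [nsmul_eq_mul]
    push_cast
    ring
  neg_mem' := by
    rintro a ⟨k, hk⟩
    exact ⟨k, by simpa using S.neg_mem hk⟩

theorem AddSubgroup.le_threeSaturation (S : AddSubgroup R) : S ≤ S.threeSaturation :=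
  fun f hf => ⟨0, by simpa using hf⟩

theorem AddSubgroup.mem_threeSaturation_of_three_mul {S : AddSubgroup R} {f : R}
    (h : 3 * f ∈ S.threeSaturation) : f ∈ S.threeSaturation := by
  obtain ⟨k, hk⟩ := h
  refine ⟨k + 1, ?_⟩
  convert hk using 1
  ring

theorem AddSubgroup.CubeClosed.threeSaturation {S : AddSubgroup R} (hS : S.CubeClosed) :
    S.threeSaturation.CubeClosed := by
  rintro a ⟨k, hk⟩
  refine ⟨3 * k, ?_⟩
  convert hS _ hk using 1
  ring

/-- A cube closed additive subgroup in which division by `3` is possible. -/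
structure AddSubgroup.CubeSaturated (T : AddSubgroup R) : Prop where
  cube_mem : ∀ {a}, a ∈ T → a ^ 3 ∈ T
  of_three_mul : ∀ {a}, 3 * a ∈ T → a ∈ T

theorem AddSubgroup.CubeClosed.cubeSaturated {S : AddSubgroup R} (hS : S.CubeClosed) :
    S.threeSaturation.CubeSaturated :=
  ⟨fun ha => hS.threeSaturation _ ha, AddSubgroup.mem_threeSaturation_of_three_mul⟩

/-! ### Odd powers of `y` in a saturated subgroup -/

namespace AddSubgroup.CubeSaturated

variable {T : AddSubgroup R} {y : R}

theorem sq_mul_add_mem (hT : T.CubeSaturated) {a b : R} (ha : a ∈ T) (hb : b ∈ T) :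
    a ^ 2 * b + a * b ^ 2 ∈ T :=
  hT.of_three_mul (AddSubgroup.CubeClosed.three_mul_mem (fun _ h => hT.cube_mem h) ha hb)

theorem two_mul_mem (hT : T.CubeSaturated) {a b c : R} (ha : a ∈ T) (hb : b ∈ T) (hc : c ∈ T) :
    2 * (a * b * c) ∈ T := by
  refine hT.of_three_mul ?_
  convert AddSubgroup.CubeClosed.six_mul_mem (fun _ h => hT.cube_mem h) ha hb hc using 1
  ring

theorem pow_three_mem (hT : T.CubeSaturated) (hy : y ∈ T) : y ^ 3 ∈ T := hT.cube_mem hy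

theorem pow_nine_mem (hT : T.CubeSaturated) (hy : y ∈ T) : y ^ 9 ∈ T := by
  convert hT.cube_mem (hT.cube_mem hy) using 1
  ring

theorem pow_twentyseven_mem (hT : T.CubeSaturated) (hy : y ∈ T) : y ^ 27 ∈ T := by
  convert hT.cube_mem (hT.pow_nine_mem hy) using 1
  ring

theorem pow_five_add_pow_seven_mem (hT : T.CubeSaturated) (hy : y ∈ T) : y ^ 5 + y ^ 7 ∈ T := by
  convert hT.sq_mul_add_mem hy (hT.pow_three_mem hy) using 1
  ring

theorem pow_eleven_add_pow_nineteen_mem (hT : T.CubeSaturated) (hy : y ∈ T) :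
    y ^ 11 + y ^ 19 ∈ T := by
  convert hT.sq_mul_add_mem hy (hT.pow_nine_mem hy) using 1
  ring

theorem pow_fifteen_add_pow_twentyone_mem (hT : T.CubeSaturated) (hy : y ∈ T) :
    y ^ 15 + y ^ 21 ∈ T := by
  convert hT.sq_mul_add_mem (hT.pow_three_mem hy) (hT.pow_nine_mem hy) using 1
  ring

theorem two_mul_pow_mem (hT : T.CubeSaturated) {a b c n : ℕ} (ha : y ^ a ∈ T) (hb : y ^ b ∈ T)
    (hc : y ^ c ∈ T) (h : a + b + c = n) : 2 * y ^ n ∈ T := by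
  convert hT.two_mul_mem ha hb hc using 1
  rw [← h, pow_add, pow_add]

/-- If `y ^ c + y ^ e ∈ T` then the doubled monomials of degrees `a + b + c` and `a + b + e` lie
in `T` together. -/
theorem two_mul_pow_mem_of_add (hT : T.CubeSaturated) {a b c e m n : ℕ} (ha : y ^ a ∈ T)
    (hb : y ^ b ∈ T) (hc : y ^ c + y ^ e ∈ T) (hm : 2 * y ^ m ∈ T) (h : a + b + c = m)
    (h' : a + b + e = n) : 2 * y ^ n ∈ T := by
  convert T.sub_mem (hT.two_mul_mem ha hb hc) hm using 1
  rw [← h, ← h', pow_add, pow_add, pow_add]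
  ring

theorem pow_eleven_add_pow_seventeen_mem (hT : T.CubeSaturated) (hy : y ∈ T) :
    y ^ 11 + y ^ 17 ∈ T := by
  have h3 := hT.pow_three_mem hy
  have h9 := hT.pow_nine_mem hy
  have h15 : 2 * y ^ 15 ∈ T := hT.two_mul_pow_mem h3 h3 h9 rfl
  have h13 : 2 * y ^ 13 ∈ T := hT.two_mul_pow_mem (a := 1) (by simpa using hy) h3 h9 rfl
  convert T.sub_mem (T.sub_mem (hT.sq_mul_add_mem (hT.pow_five_add_pow_seven_mem hy) h3) h15) h13
    using 1
  ring

/-- Most degrees are powers of 3 or sums of three of them. The exceptions 17, 23, 25, 35 have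
ternary digit sum 5 and need the relations between two powers. The bound 37 is the largest degree to
be cleared in `pow_thirteen_add_mem`. -/
theorem two_mul_small_pow_mem (hT : T.CubeSaturated) (hy : y ∈ T) {n : ℕ} (hn : n ≤ 37)
    (hodd : Odd n) : 2 * y ^ n ∈ T := by
  have h1 : y ^ 1 ∈ T := by simpa using hy
  have h3 := hT.pow_three_mem hy
  have h9 := hT.pow_nine_mem hy
  have h27 := hT.pow_twentyseven_mem hy
  have h57 := hT.pow_five_add_pow_seven_mem hy
  have h1117 := hT.pow_eleven_add_pow_seventeen_mem hy
  have dbl : ∀ {k}, y ^ k ∈ T → 2 * y ^ k ∈ T := fun h => by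
    rw [two_mul]; exact T.add_mem h h
  have d15 : 2 * y ^ 15 ∈ T := hT.two_mul_pow_mem h3 h3 h9 rfl
  have d17 : 2 * y ^ 17 ∈ T := hT.two_mul_pow_mem_of_add h1 h9 h57 d15 rfl rfl
  have d23 : 2 * y ^ 23 ∈ T := hT.two_mul_pow_mem_of_add h3 h3 h1117 d17 rfl rfl
  have d29 : 2 * y ^ 29 ∈ T := hT.two_mul_pow_mem h27 h1 h1 rfl
  obtain ⟨m, rfl⟩ := hodd
  have hm : m ≤ 18 := by omega
  interval_cases m
  · exact dbl h1
  · exact dbl h3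
  · exact hT.two_mul_pow_mem h1 h1 h3 rfl
  · exact hT.two_mul_pow_mem h1 h3 h3 rfl
  · exact dbl h9
  · exact hT.two_mul_pow_mem h1 h1 h9 rfl
  · exact hT.two_mul_pow_mem h1 h3 h9 rfl
  · exact d15
  · exact d17
  · exact hT.two_mul_pow_mem h1 h9 h9 rfl
  · exact hT.two_mul_pow_mem h3 h9 h9 rfl
  · exact d23
  · exact hT.two_mul_pow_mem_of_add h9 h9 h57 d23 rfl rfl
  · exact dbl h27
  · exact d29
  · exact hT.two_mul_pow_mem h27 h1 h3 rfl
  · exact hT.two_mul_pow_mem h27 h3 h3 rfl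
  · exact hT.two_mul_pow_mem_of_add h9 h9 h1117 d29 rfl rfl
  · exact hT.two_mul_pow_mem h27 h1 h9 rfl

end AddSubgroup.CubeSaturated

/-- The sum of `T` and the additive subgroup generated by `y ^ 5` and `y ^ 11`. -/
def AddSubgroup.adjoinPow (T : AddSubgroup R) (y : R) : AddSubgroup R where
  carrier := {f | ∃ α β : ℤ, f + α * y ^ 5 + β * y ^ 11 ∈ T}
  zero_mem' := ⟨0, 0, by simp⟩
  add_mem' := by
    rintro f g ⟨α, β, h⟩ ⟨α', β', h'⟩
    refine ⟨α + α', β + β', ?_⟩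
    convert T.add_mem h h' using 1
    push_cast
    ring
  neg_mem' := by
    rintro f ⟨α, β, h⟩
    refine ⟨-α, -β, ?_⟩
    convert T.neg_mem h using 1
    push_cast
    ring

theorem AddSubgroup.mem_adjoinPow {T : AddSubgroup R} {y f : R} :
    f ∈ T.adjoinPow y ↔ ∃ α β : ℤ, f + α * y ^ 5 + β * y ^ 11 ∈ T := Iff.rfl

theorem AddSubgroup.le_adjoinPow (T : AddSubgroup R) (y : R) : T ≤ T.adjoinPow y :=
  fun f hf => ⟨0, 0, by simpa using hf⟩

theorem AddSubgroup.pow_five_mem_adjoinPow (T : AddSubgroup R) (y : R) : y ^ 5 ∈ T.adjoinPow y :=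
  ⟨-1, 0, by simp⟩

theorem AddSubgroup.pow_eleven_mem_adjoinPow (T : AddSubgroup R) (y : R) :
    y ^ 11 ∈ T.adjoinPow y :=
  ⟨0, -1, by simp⟩

theorem AddSubgroup.intCast_mul_mem (S : AddSubgroup R) (n : ℤ) {a : R} (ha : a ∈ S) :
    (n : R) * a ∈ S := by
  rw [← zsmul_eq_mul]
  exact S.zsmul_mem ha n

namespace AddSubgroup.CubeSaturated

variable {T : AddSubgroup R} {y : R}

theorem pow_five_add_pow_eleven_add_pow_fifteen_mem (hT : T.CubeSaturated) (hy : y ∈ T) :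
    y ^ 5 + y ^ 11 + y ^ 15 ∈ T := by
  have h13 : 2 * y ^ 13 ∈ T := hT.two_mul_small_pow_mem hy (by norm_num) (by decide)
  have h7 : 2 * y ^ 7 ∈ T := hT.two_mul_small_pow_mem hy (by norm_num) (by decide)
  have h := T.sub_mem (hT.sq_mul_add_mem (hT.pow_five_add_pow_seven_mem hy) hy) h13
  have h' := T.sub_mem (T.add_mem (T.sub_mem h (hT.pow_nine_mem hy))
    (hT.pow_five_add_pow_seven_mem hy)) h7
  convert h' using 1
  ring

/-- Doubled odd monomials up to degree 37 are available, so only parities of coefficients matter.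
The three polarised products are chosen so that modulo 2 all degrees but 13, 21, 25, 27 cancel; the
subtractions clear the even remainders. The next lemma works in the same way. -/
theorem pow_thirteen_add_mem (hT : T.CubeSaturated) (hy : y ∈ T) :
    y ^ 13 + y ^ 21 + y ^ 25 + y ^ 27 ∈ T := by
  have d : ∀ n ≤ 37, Odd n → 2 * y ^ n ∈ T := fun n hn ho => hT.two_mul_small_pow_mem hy hn ho
  have a := hT.pow_eleven_add_pow_seventeen_mem hy
  have b := hT.pow_five_add_pow_eleven_add_pow_fifteen_mem hy
  have c := hT.pow_five_add_pow_seven_mem hy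
  have h := T.add_mem (T.add_mem (hT.sq_mul_add_mem hy a)
    (hT.sq_mul_add_mem (hT.pow_three_mem hy) a)) (hT.sq_mul_add_mem c b)
  have h := T.sub_mem h (T.zsmul_mem (d 15 (by norm_num) (by decide)) (1))
  have h := T.sub_mem h (T.zsmul_mem (d 17 (by norm_num) (by decide)) (2))
  have h := T.sub_mem h (T.zsmul_mem (d 19 (by norm_num) (by decide)) (1))
  have h := T.sub_mem h (T.zsmul_mem (d 21 (by norm_num) (by decide)) (1))
  have h := T.sub_mem h (T.zsmul_mem (d 23 (by norm_num) (by decide)) (3))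
  have h := T.sub_mem h (T.zsmul_mem (d 25 (by norm_num) (by decide)) (2))
  have h := T.sub_mem h (T.zsmul_mem (d 27 (by norm_num) (by decide)) (2))
  have h := T.sub_mem h (T.zsmul_mem (d 29 (by norm_num) (by decide)) (2))
  have h := T.sub_mem h (T.zsmul_mem (d 31 (by norm_num) (by decide)) (2))
  have h := T.sub_mem h (T.zsmul_mem (d 33 (by norm_num) (by decide)) (1))
  have h := T.sub_mem h (T.zsmul_mem (d 35 (by norm_num) (by decide)) (1))
  have h := T.sub_mem h (T.zsmul_mem (d 37 (by norm_num) (by decide)) (1))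
  convert h using 1
  ring

theorem pow_thirteen_add_pow_twentythree_mem (hT : T.CubeSaturated) (hy : y ∈ T) :
    y ^ 11 + y ^ 13 + y ^ 19 + y ^ 23 ∈ T := by
  have d : ∀ n ≤ 37, Odd n → 2 * y ^ n ∈ T := fun n hn ho => hT.two_mul_small_pow_mem hy hn ho
  have a := hT.pow_eleven_add_pow_seventeen_mem hy
  have b := hT.pow_five_add_pow_eleven_add_pow_fifteen_mem hy
  have c := hT.pow_five_add_pow_seven_mem hy
  have h := T.sub_mem (T.add_mem (T.sub_mem (hT.sq_mul_add_mem (hT.pow_three_mem hy) b)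
    (hT.sq_mul_add_mem (hT.pow_three_mem hy) (hT.pow_eleven_add_pow_nineteen_mem hy)))
    (hT.sq_mul_add_mem c a)) (hT.sq_mul_add_mem (hT.pow_nine_mem hy) b)
  have h := T.sub_mem h (T.zsmul_mem (d 21 (by norm_num) (by decide)) (1))
  have h := T.sub_mem h (T.zsmul_mem (d 23 (by norm_num) (by decide)) (1))
  have h := T.sub_mem h (T.zsmul_mem (d 25 (by norm_num) (by decide)) (-1))
  have h := T.sub_mem h (T.zsmul_mem (d 27 (by norm_num) (by decide)) (1))
  have h := T.sub_mem h (T.zsmul_mem (d 29 (by norm_num) (by decide)) (1))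
  convert h using 1
  ring

/-- Each relation in `T` contains one new power, solved for in the order 7, 15, 17, 19, 21, 25, 13,
23. The bound 25 is what the later induction needs: it uses `y ^ (22 + k)` with k at most 3. -/
theorem small_pow_mem_adjoinPow (hT : T.CubeSaturated) (hy : y ∈ T) {n : ℕ} (hn : n ≤ 25)
    (hodd : Odd n) : y ^ n ∈ T.adjoinPow y := by
  have of_add : ∀ {a b : R}, a ∈ T.adjoinPow y → a + b ∈ T → b ∈ T.adjoinPow y := by
    intro a b ha hab
    simpa using (T.adjoinPow y).sub_mem (T.le_adjoinPow y hab) ha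
  have h5 := T.pow_five_mem_adjoinPow y
  have h11 := T.pow_eleven_mem_adjoinPow y
  have h7 := of_add h5 (hT.pow_five_add_pow_seven_mem hy)
  have h15 := of_add ((T.adjoinPow y).add_mem h5 h11)
    (hT.pow_five_add_pow_eleven_add_pow_fifteen_mem hy)
  have h17 := of_add h11 (hT.pow_eleven_add_pow_seventeen_mem hy)
  have h19 := of_add h11 (hT.pow_eleven_add_pow_nineteen_mem hy)
  have h21 := of_add h15 (hT.pow_fifteen_add_pow_twentyone_mem hy)
  have h25 : y ^ 25 ∈ T.adjoinPow y := by
    refine of_add h19 ?_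
    have h := T.sub_mem (T.sub_mem (hT.sq_mul_add_mem (hT.pow_nine_mem hy)
      (hT.pow_five_add_pow_seven_mem hy))
      (hT.two_mul_small_pow_mem hy (n := 21) (by norm_num) (by decide)))
      (hT.two_mul_small_pow_mem hy (n := 23) (by norm_num) (by decide))
    convert h using 1
    ring
  have h27 := T.le_adjoinPow y (hT.pow_twentyseven_mem hy)
  have h13 : y ^ 13 ∈ T.adjoinPow y := by
    refine of_add ((T.adjoinPow y).add_mem ((T.adjoinPow y).add_mem h21 h25) h27) ?_
    convert hT.pow_thirteen_add_mem hy using 1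
    ring
  have h23 := of_add ((T.adjoinPow y).add_mem ((T.adjoinPow y).add_mem h11 h13) h19)
    (hT.pow_thirteen_add_pow_twentythree_mem hy)
  obtain ⟨m, rfl⟩ := hodd
  have hm : m ≤ 12 := by omega
  interval_cases m
  · exact T.le_adjoinPow y (by simpa using hy)
  · exact T.le_adjoinPow y (hT.pow_three_mem hy)
  · exact h5
  · exact h7
  · exact T.le_adjoinPow y (hT.pow_nine_mem hy)
  · exact h11
  · exact h13
  · exact h15
  · exact h17
  · exact h19
  · exact h21
  · exact h23
  · exact h25

/-- Multiplying by 2y² turns the corrections y^5 and y^11 into 2y^7 and 2y^13, which lie in `T`. -/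
theorem two_mul_pow_add_two_mem (hT : T.CubeSaturated) (hy : y ∈ T) {n : ℕ}
    (hn : y ^ n ∈ T.adjoinPow y) : 2 * y ^ (n + 2) ∈ T := by
  obtain ⟨α, β, h⟩ := hn
  have h7 : 2 * y ^ 7 ∈ T := hT.two_mul_small_pow_mem hy (by norm_num) (by decide)
  have h13 : 2 * y ^ 13 ∈ T := hT.two_mul_small_pow_mem hy (by norm_num) (by decide)
  convert T.sub_mem (T.sub_mem (hT.two_mul_mem h hy hy) (T.intCast_mul_mem α h7))
    (T.intCast_mul_mem β h13) using 1
  ring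

/-- Expanding `a ^ 2 * y ^ k + a * y ^ (2 * k)` for `a = y ^ n + α * y ^ 5 + β * y ^ 11` gives
`y ^ (2 * n + k)` in terms of lower powers. -/
theorem pow_two_mul_add_mem_adjoinPow (hT : T.CubeSaturated) {n k : ℕ}
    (hk : y ^ k ∈ T) (hn : y ^ n ∈ T.adjoinPow y)
    (h₁ : 2 * y ^ (n + 5 + k) ∈ T) (h₂ : 2 * y ^ (n + 11 + k) ∈ T) (h₃ : 2 * y ^ (16 + k) ∈ T)
    (h₄ : y ^ (10 + k) ∈ T.adjoinPow y) (h₅ : y ^ (22 + k) ∈ T.adjoinPow y)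
    (h₆ : y ^ (n + 2 * k) ∈ T.adjoinPow y) (h₇ : y ^ (5 + 2 * k) ∈ T.adjoinPow y)
    (h₈ : y ^ (11 + 2 * k) ∈ T.adjoinPow y) : y ^ (2 * n + k) ∈ T.adjoinPow y := by
  obtain ⟨α, β, h⟩ := hn
  set W := T.adjoinPow y
  have hW : T ≤ W := T.le_adjoinPow y
  have key := hW (hT.sq_mul_add_mem h hk)
  have key := W.sub_mem key (W.intCast_mul_mem α (hW h₁))
  have key := W.sub_mem key (W.intCast_mul_mem β (hW h₂))
  have key := W.sub_mem key (W.intCast_mul_mem (α * β) (hW h₃))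
  have key := W.sub_mem key (W.intCast_mul_mem (α ^ 2) h₄)
  have key := W.sub_mem key (W.intCast_mul_mem (β ^ 2) h₅)
  have key := W.sub_mem key h₆
  have key := W.sub_mem key (W.intCast_mul_mem α h₇)
  have key := W.sub_mem key (W.intCast_mul_mem β h₈)
  convert key using 1
  push_cast
  ring

theorem pow_mem_adjoinPow_and_two_mul_pow_mem (hT : T.CubeSaturated) (hy : y ∈ T) (n : ℕ)
    (hodd : Odd n) : y ^ n ∈ T.adjoinPow y ∧ 2 * y ^ n ∈ T := by
  induction n using Nat.strong_induction_on with
  | _ n ih =>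
    rcases le_or_gt n 25 with hn | hn
    · exact ⟨hT.small_pow_mem_adjoinPow hy hn hodd,
        hT.two_mul_small_pow_mem hy (by omega) hodd⟩
    have lo : ∀ m, m < n → m % 2 = 1 → y ^ m ∈ T.adjoinPow y := fun m hm ho =>
      (ih m hm (Nat.odd_iff.2 ho)).1
    have two : ∀ m, m ≤ n → m % 2 = 1 → 2 * y ^ m ∈ T := by
      intro m hm ho
      rcases lt_or_ge m 2 with h | h
      · exact hT.two_mul_small_pow_mem hy (by omega) (Nat.odd_iff.2 ho)
      · obtain ⟨l, rfl⟩ := Nat.exists_eq_add_of_le' h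
        exact hT.two_mul_pow_add_two_mem hy (lo l (by omega) (by omega))
    have ho := Nat.odd_iff.1 hodd
    refine ⟨?_, two n le_rfl ho⟩
    -- Write n = 2i + k with k = 1 or 3, chosen so that i is odd.
    rcases (by omega : n % 4 = 3 ∨ n % 4 = 1) with h | h
    · obtain ⟨i, rfl, hi⟩ : ∃ i, n = 2 * i + 1 ∧ i % 2 = 1 := ⟨n / 2, by omega, by omega⟩
      apply hT.pow_two_mul_add_mem_adjoinPow (by simpa using hy)
      all_goals first
        | exact lo _ (by omega) (by omega)
        | exact two _ (by omega) (by omega)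
    · obtain ⟨i, rfl, hi⟩ : ∃ i, n = 2 * i + 3 ∧ i % 2 = 1 := ⟨(n - 3) / 2, by omega, by omega⟩
      apply hT.pow_two_mul_add_mem_adjoinPow (hT.pow_three_mem hy)
      all_goals first
        | exact lo _ (by omega) (by omega)
        | exact two _ (by omega) (by omega)

end AddSubgroup.CubeSaturated
end CubeClosed

/-! ### Ternary digit sums and divisibility by powers of 3 -/

theorem digitSum_three_mul (n : ℕ) : digitSum 3 (3 * n) = digitSum 3 n := by
  rcases Nat.eq_zero_or_pos n with rfl | hn
  · rfl
  · rw [digitSum, digitSum, Nat.digits_def' (by norm_num) (by omega)]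
    simp

theorem digitSum_three_eq (n : ℕ) : digitSum 3 n = n % 3 + digitSum 3 (n / 3) := by
  rcases Nat.eq_zero_or_pos n with rfl | hn
  · rfl
  · rw [digitSum, digitSum, Nat.digits_def' (by norm_num) hn]
    simp

/-- Legendre's formula gives 2 v₃(n!) = n - s₃(n), and a! b! divides (a+b)!. -/
theorem digitSum_three_add_le (a b : ℕ) :
    digitSum 3 (a + b) ≤ digitSum 3 a + digitSum 3 b := by
  have : Fact (Nat.Prime 3) := ⟨Nat.prime_three⟩
  have h : ∀ n, 2 * padicValNat 3 n.factorial + digitSum 3 n = n := fun n => by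
    have h₁ := sub_one_mul_padicValNat_factorial (p := 3) n
    have h₂ := Nat.digit_sum_le 3 n
    simp only [digitSum]
    omega
  have hab := h (a + b)
  have ha := h a
  have hb := h b
  have hle : padicValNat 3 a.factorial + padicValNat 3 b.factorial ≤
      padicValNat 3 (a + b).factorial := by
    rw [← padicValNat.mul a.factorial_ne_zero b.factorial_ne_zero]
    exact padicValNat_dvd_iff_le (Nat.factorial_ne_zero _) |>.1
      (pow_padicValNat_dvd.trans (Nat.factorial_mul_factorial_dvd_factorial_add a b))
  omega

theorem digitSum_three_mod_two (n : ℕ) : digitSum 3 n % 2 = n % 2 :=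
  (Nat.modEq_digits_sum 2 3 (by norm_num) n).symm

/-- Removing a power of `3` from `n` that occurs in its ternary expansion. -/
theorem exists_eq_add_three_pow {n : ℕ} (hn : 0 < n) :
    ∃ m j, n = m + 3 ^ j ∧ digitSum 3 n = digitSum 3 m + 1 := by
  induction n using Nat.strong_induction_on with
  | _ n ih =>
    by_cases h : n % 3 = 0
    · obtain ⟨t, rfl⟩ := Nat.dvd_of_mod_eq_zero h
      obtain ⟨m, j, rfl, hs⟩ := ih t (by omega) (by omega)
      exact ⟨3 * m, j + 1, by ring, by rw [digitSum_three_mul, digitSum_three_mul, hs]⟩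
    · refine ⟨n - 1, 0, by simp; omega, ?_⟩
      rw [digitSum_three_eq n, digitSum_three_eq (n - 1), show (n - 1) / 3 = n / 3 by omega]
      omega

/-- The integer polynomials supported in degrees congruent to `3` modulo `6` whose coefficients
have the powers of `3` prescribed by the ternary digit sum of the degree. -/
def digitSumSubgroup : AddSubgroup ℤ[X] where
  carrier := {p | (∀ i : ℕ, i % 6 ≠ 3 → p.coeff i = 0) ∧
    ∀ i : ℕ, i % 6 = 3 → (3 : ℤ) ^ ((digitSum 3 i - 1) / 2) ∣ p.coeff i}
  zero_mem' := by simp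
  add_mem' := by
    rintro a b ⟨ha, ha'⟩ ⟨hb, hb'⟩
    refine ⟨fun i hi => by simp [ha i hi, hb i hi], fun i hi => ?_⟩
    rw [coeff_add]
    exact dvd_add (ha' i hi) (hb' i hi)
  neg_mem' := by
    rintro a ⟨ha, ha'⟩
    refine ⟨fun i hi => by simp [ha i hi], fun i hi => ?_⟩
    rw [coeff_neg]
    exact (ha' i hi).neg_right

theorem mem_digitSumSubgroup {p : ℤ[X]} : p ∈ digitSumSubgroup ↔
    (∀ i : ℕ, i % 6 ≠ 3 → p.coeff i = 0) ∧
      ∀ i : ℕ, i % 6 = 3 → (3 : ℤ) ^ ((digitSum 3 i - 1) / 2) ∣ p.coeff i := Iff.rfl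

/-- For odd digit sums s, s', s'' the exponents (s-1)/2 add up, with the extra factor 3, to
(s+s'+s''-1)/2, which subadditivity bounds from below. -/
theorem three_mul_mul_mul_mem_digitSumSubgroup {a b c : ℤ[X]} (ha : a ∈ digitSumSubgroup)
    (hb : b ∈ digitSumSubgroup) (hc : c ∈ digitSumSubgroup) :
    3 * (a * b * c) ∈ digitSumSubgroup := by
  have hcoeff : ∀ n, (3 * (a * b * c)).coeff n =
      ∑ x ∈ Finset.HasAntidiagonal.antidiagonal n, ∑ z ∈ Finset.HasAntidiagonal.antidiagonal x.1,
        3 * (a.coeff z.1 * b.coeff z.2 * c.coeff x.2) := by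
    intro n
    rw [show (3 : ℤ[X]) = C 3 from rfl, coeff_C_mul, coeff_mul, Finset.mul_sum]
    refine Finset.sum_congr rfl fun x _ => ?_
    rw [coeff_mul, Finset.sum_mul, Finset.mul_sum]
  refine ⟨fun n hn => ?_, fun n hn => ?_⟩
  · rw [hcoeff]
    refine Finset.sum_eq_zero fun x hx => Finset.sum_eq_zero fun z hz => ?_
    rw [Finset.HasAntidiagonal.mem_antidiagonal] at hx hz
    by_cases h₁ : z.1 % 6 = 3
    · by_cases h₂ : z.2 % 6 = 3
      · rw [hc.1 x.2 (by omega), mul_zero, mul_zero]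
      · rw [hb.1 _ h₂]; simp
    · rw [ha.1 _ h₁]; simp
  · rw [hcoeff]
    refine Finset.dvd_sum fun x hx => Finset.dvd_sum fun z hz => ?_
    rw [Finset.HasAntidiagonal.mem_antidiagonal] at hx hz
    by_cases h₁ : z.1 % 6 = 3
    · by_cases h₂ : z.2 % 6 = 3
      · have h₃ : x.2 % 6 = 3 := by omega
        have hd := mul_dvd_mul (mul_dvd_mul (ha.2 _ h₁) (hb.2 _ h₂)) (hc.2 _ h₃)
        have hd := mul_dvd_mul_left 3 hd
        refine dvd_trans ?_ hd
        rw [← pow_add, ← pow_add, ← pow_succ']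
        apply pow_dvd_pow
        have e₁ := digitSum_three_mod_two z.1
        have e₂ := digitSum_three_mod_two z.2
        have e₃ := digitSum_three_mod_two x.2
        have l₁ := digitSum_three_add_le z.1 z.2
        have l₂ := digitSum_three_add_le x.1 x.2
        rw [hz] at l₁
        rw [hx] at l₂
        omega
      · rw [hb.1 _ h₂]; simp
    · rw [ha.1 _ h₁]; simp

theorem C_mul_X_pow_mem_digitSumSubgroup {c : ℤ} {i : ℕ} (hi : i % 6 = 3)
    (hc : (3 : ℤ) ^ ((digitSum 3 i - 1) / 2) ∣ c) : C c * X ^ i ∈ digitSumSubgroup := by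
  refine ⟨fun j hj => ?_, fun j _ => ?_⟩
  · rw [coeff_C_mul_X_pow, if_neg (by rintro rfl; exact hj hi)]
  · rw [coeff_C_mul_X_pow]
    split_ifs with h
    · rwa [h]
    · exact dvd_zero _

theorem digitSumSubgroup_induction {P : ℤ[X] → Prop} (zero : P 0)
    (add : ∀ a ∈ digitSumSubgroup, ∀ b ∈ digitSumSubgroup, P a → P b → P (a + b))
    (mono : ∀ (c : ℤ) (i : ℕ), i % 6 = 3 → (3 : ℤ) ^ ((digitSum 3 i - 1) / 2) ∣ c →
      P (C c * X ^ i)) {p : ℤ[X]} (hp : p ∈ digitSumSubgroup) : P p := by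
  have hterm : ∀ i ∈ p.support, i % 6 = 3 := fun i hi => by
    by_contra h
    exact mem_support_iff.1 hi (hp.1 i h)
  rw [p.as_sum_support_C_mul_X_pow]
  suffices ∀ s ⊆ p.support, ∑ i ∈ s, C (p.coeff i) * X ^ i ∈ digitSumSubgroup ∧
      P (∑ i ∈ s, C (p.coeff i) * X ^ i) from (this _ subset_rfl).2
  intro s
  induction s using Finset.induction_on with
  | empty => exact fun _ => ⟨by simp, by simpa using zero⟩
  | insert i s his ih =>
    intro hs
    rw [Finset.insert_subset_iff] at hs
    obtain ⟨hmem, hP⟩ := ih hs.2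
    have hi := hterm i hs.1
    have hi' := C_mul_X_pow_mem_digitSumSubgroup hi (hp.2 i hi)
    rw [Finset.sum_insert his]
    exact ⟨AddSubgroup.add_mem _ hi' hmem, add _ hi' _ hmem (mono _ _ hi (hp.2 i hi)) hP⟩

theorem digitSumSubgroup_cubeClosed : digitSumSubgroup.CubeClosed := by
  intro p hp
  refine digitSumSubgroup_induction (P := fun p => p ^ 3 ∈ digitSumSubgroup) (by simp)
    (fun a ha b hb iha ihb => ?_) (fun c i hi hc => ?_) hp
  · have h := digitSumSubgroup.add_mem (digitSumSubgroup.add_mem iha ihb)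
      (digitSumSubgroup.add_mem (three_mul_mul_mul_mem_digitSumSubgroup ha ha hb)
        (three_mul_mul_mul_mem_digitSumSubgroup ha hb hb))
    convert h using 1
    ring
  · rw [mul_pow, ← C_pow, ← pow_mul, mul_comm i 3]
    refine C_mul_X_pow_mem_digitSumSubgroup (by omega) ?_
    rw [digitSum_three_mul]
    exact dvd_pow hc (by norm_num)

/-! ### Parity functionals modulo 2 -/

section ParityFunctional

/-- The linear functional on polynomials over `ZMod 2` with value `w n` at `X ^ n`. -/
noncomputable def weightSum (w : ℕ → ZMod 2) : (ZMod 2)[X] →ₗ[ZMod 2] ZMod 2 :=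
  Polynomial.lsum fun n => w n • LinearMap.id

theorem weightSum_C_mul_X_pow (w : ℕ → ZMod 2) (c : ZMod 2) (n : ℕ) :
    weightSum w (C c * X ^ n) = w n * c := by
  simp [weightSum, Polynomial.lsum_apply, C_mul_X_pow_eq_monomial]

theorem weightSum_X_pow (w : ℕ → ZMod 2) (n : ℕ) : weightSum w (X ^ n) = w n := by
  simpa using weightSum_C_mul_X_pow w 1 n

/-- The additive subgroup spanned by the powers of `X` with exponent congruent to `3` modulo
`6`. -/
noncomputable def powSpan : AddSubgroup (ZMod 2)[X] :=
  AddSubgroup.closure {q | ∃ i : ℕ, i % 6 = 3 ∧ q = X ^ i}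

/-- In characteristic 2 squaring is additive, so a²b + ab² is biadditive and monomials suffice. -/
theorem weightSum_sq_mul_add {w w₀ : ℕ → ZMod 2}
    (h : ∀ i j : ℕ, i % 6 = 3 → j % 6 = 3 → w (2 * i + j) + w (i + 2 * j) = w₀ i + w₀ j)
    {a b : (ZMod 2)[X]} (ha : a ∈ powSpan) (hb : b ∈ powSpan) :
    weightSum w (a ^ 2 * b + a * b ^ 2) =
      weightSum w₀ a * b.eval 1 + a.eval 1 * weightSum w₀ b := by
  have hneg : ∀ a b : (ZMod 2)[X], (-a) ^ 2 * b + (-a) * b ^ 2 = a ^ 2 * b + a * b ^ 2 := by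
    intro a b
    rw [CharTwo.neg_eq]
  induction ha using AddSubgroup.closure_induction with
  | zero => simp
  | neg a _ iha => rw [hneg, iha, CharTwo.neg_eq]
  | add a a' _ _ iha iha' =>
    rw [CharTwo.add_sq, show (a ^ 2 + a' ^ 2) * b + (a + a') * b ^ 2 =
      (a ^ 2 * b + a * b ^ 2) + (a' ^ 2 * b + a' * b ^ 2) by ring, map_add, iha, iha', map_add,
      eval_add]
    ring
  | mem a ha =>
    obtain ⟨i, hi, rfl⟩ := ha
    induction hb using AddSubgroup.closure_induction with
    | zero => simp
    | neg b _ ihb => rw [CharTwo.neg_eq, ihb]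
    | add b b' _ _ ihb ihb' =>
      rw [CharTwo.add_sq, show ((X : (ZMod 2)[X]) ^ i) ^ 2 * (b + b') + X ^ i * (b ^ 2 + b' ^ 2) =
        ((X ^ i) ^ 2 * b + X ^ i * b ^ 2) + ((X ^ i) ^ 2 * b' + X ^ i * b' ^ 2) by ring, map_add,
        ihb, ihb', map_add, eval_add]
      ring
    | mem b hb =>
      obtain ⟨j, hj, rfl⟩ := hb
      have e₁ : ((X : (ZMod 2)[X]) ^ i) ^ 2 * X ^ j = X ^ (2 * i + j) := by ring
      have e₂ : (X : (ZMod 2)[X]) ^ i * (X ^ j) ^ 2 = X ^ (i + 2 * j) := by ring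
      rw [e₁, e₂, map_add]
      simp only [weightSum_X_pow, eval_pow, eval_X, one_pow, mul_one, one_mul]
      exact h i j hi hj

/-- On cubes the functional with weight `w` factors as the functional with weight `w₀` times the
sum of the coefficients. -/
theorem weightSum_cube {w w₀ : ℕ → ZMod 2}
    (h : ∀ i j : ℕ, i % 6 = 3 → j % 6 = 3 → w (2 * i + j) + w (i + 2 * j) = w₀ i + w₀ j)
    (h' : ∀ i : ℕ, i % 6 = 3 → w (3 * i) = w₀ i) {q : (ZMod 2)[X]} (hq : q ∈ powSpan) :
    weightSum w (q ^ 3) = weightSum w₀ q * q.eval 1 := by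
  induction hq using AddSubgroup.closure_induction with
  | zero => simp
  | neg q _ ih => rw [CharTwo.neg_eq, ih]
  | add a b ha hb iha ihb =>
    have e : (a + b) ^ 3 = a ^ 3 + b ^ 3 + (a ^ 2 * b + a * b ^ 2) := by
      linear_combination (a ^ 2 * b + a * b ^ 2) * (CharTwo.two_eq_zero : (2 : (ZMod 2)[X]) = 0)
    rw [e, map_add, map_add, iha, ihb, weightSum_sq_mul_add h ha hb, map_add, eval_add]
    ring
  | mem q hq =>
    obtain ⟨i, hi, rfl⟩ := hq
    rw [← pow_mul, mul_comm i 3, weightSum_X_pow, weightSum_X_pow, h' i hi]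
    simp

theorem map_mem_powSpan {p : ℤ[X]} (hp : ∀ i : ℕ, i % 6 ≠ 3 → p.coeff i = 0) :
    p.map (Int.castRingHom (ZMod 2)) ∈ powSpan := by
  rw [p.as_sum_support_C_mul_X_pow, Polynomial.map_sum]
  refine AddSubgroup.sum_mem _ fun i hi => ?_
  have hi' : i % 6 = 3 := by
    by_contra h
    exact mem_support_iff.1 hi (hp i h)
  have h := powSpan.zsmul_mem (AddSubgroup.subset_closure ⟨i, hi', rfl⟩) (p.coeff i)
  convert h using 1
  rw [zsmul_eq_mul]
  simp

/-- The sum, modulo `2`, of the coefficients of `p` in the degrees satisfying `P`. -/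
noncomputable def paritySum (P : ℕ → Prop) [DecidablePred P] : ℤ[X] →+ ZMod 2 :=
  (weightSum fun n => if P n then 1 else 0).toAddMonoidHom.comp
    (mapRingHom (Int.castRingHom (ZMod 2))).toAddMonoidHom

theorem paritySum_apply (P : ℕ → Prop) [DecidablePred P] (p : ℤ[X]) :
    paritySum P p =
      weightSum (fun n => if P n then 1 else 0) (p.map (Int.castRingHom (ZMod 2))) := rfl

theorem paritySum_C_mul_X_pow (P : ℕ → Prop) [DecidablePred P] (c : ℤ) (n : ℕ) :
    paritySum P (C c * X ^ n) = if P n then (c : ZMod 2) else 0 := by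
  rw [paritySum_apply, Polynomial.map_mul, map_C, Polynomial.map_pow, map_X,
    weightSum_C_mul_X_pow]
  split_ifs <;> simp

theorem two_dvd_sum_iff (P : ℕ → Prop) [DecidablePred P] (p : ℤ[X]) :
    (2 : ℤ) ∣ ∑ j ∈ p.support with P j, p.coeff j ↔ paritySum P p = 0 := by
  have h : paritySum P p = ((∑ j ∈ p.support with P j, p.coeff j : ℤ) : ZMod 2) := by
    conv_lhs => rw [p.as_sum_support_C_mul_X_pow, map_sum]
    simp only [paritySum_C_mul_X_pow]
    rw [← Finset.sum_filter]
    push_cast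
    rfl
  rw [h]
  exact (ZMod.intCast_zmod_eq_zero_iff_dvd _ 2).symm

abbrev FirstParityDegree (j : ℕ) : Prop := j % 24 ∈ ({15, 21} : Finset ℕ)

/-- The exception `j ≠ 3` admits the generator `X ^ 3`. It does not affect cubes of polynomials
supported in degrees 3 modulo 6, whose terms have degree at least 9. -/
abbrev SecondParityDegree (j : ℕ) : Prop :=
  j % 72 ∈ ({3, 33, 45, 51, 57, 63} : Finset ℕ) ∧ j ≠ 3

theorem firstParity_cross (i j : ℕ) (hi : i % 6 = 3) (hj : j % 6 = 3) :
    ((if FirstParityDegree (2 * i + j) then 1 else 0 : ZMod 2) +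
      if FirstParityDegree (i + 2 * j) then 1 else 0) =
      (if FirstParityDegree i then 1 else 0) + if FirstParityDegree j then 1 else 0 := by
  -- Only residues modulo 24 matter, and those congruent to 3 modulo 6 are 6a + 3 with a < 4.
  have key : ∀ a < 4, ∀ b < 4,
      ((if (2 * (6 * a + 3) + (6 * b + 3)) % 24 ∈ ({15, 21} : Finset ℕ) then 1 else 0 : ZMod 2) +
      if ((6 * a + 3) + 2 * (6 * b + 3)) % 24 ∈ ({15, 21} : Finset ℕ) then 1 else 0) =
      (if (6 * a + 3) ∈ ({15, 21} : Finset ℕ) then 1 else 0) +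
        if (6 * b + 3) ∈ ({15, 21} : Finset ℕ) then 1 else 0 := by decide
  have h := key (i % 24 / 6) (by omega) (j % 24 / 6) (by omega)
  rw [show 6 * (i % 24 / 6) + 3 = i % 24 by omega, show 6 * (j % 24 / 6) + 3 = j % 24 by omega,
    show (2 * (i % 24) + j % 24) % 24 = (2 * i + j) % 24 by omega,
    show (i % 24 + 2 * (j % 24)) % 24 = (i + 2 * j) % 24 by omega] at h
  exact h

theorem firstParity_cube (i : ℕ) (hi : i % 6 = 3) :
    (if FirstParityDegree (3 * i) then 1 else 0 : ZMod 2) =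
      if FirstParityDegree i then 1 else 0 := by
  simp only [FirstParityDegree, Finset.mem_insert, Finset.mem_singleton]
  congr 1
  apply propext
  omega

theorem secondParityDegree_iff {j : ℕ} (hj : 3 < j) :
    SecondParityDegree j ↔ j % 72 ∈ ({3, 33, 45, 51, 57, 63} : Finset ℕ) :=
  and_iff_left hj.ne'

theorem secondParity_cross (i j : ℕ) (hi : i % 6 = 3) (hj : j % 6 = 3) :
    ((if SecondParityDegree (2 * i + j) then 1 else 0 : ZMod 2) +
      if SecondParityDegree (i + 2 * j) then 1 else 0) =
      (if FirstParityDegree i then 1 else 0) + if FirstParityDegree j then 1 else 0 := by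
  have key : ∀ a < 12, ∀ b < 12,
      ((if (2 * (6 * a + 3) + (6 * b + 3)) % 72 ∈ ({3, 33, 45, 51, 57, 63} : Finset ℕ)
        then 1 else 0 : ZMod 2) +
      if ((6 * a + 3) + 2 * (6 * b + 3)) % 72 ∈ ({3, 33, 45, 51, 57, 63} : Finset ℕ)
        then 1 else 0) =
      (if (6 * a + 3) % 24 ∈ ({15, 21} : Finset ℕ) then 1 else 0) +
        if (6 * b + 3) % 24 ∈ ({15, 21} : Finset ℕ) then 1 else 0 := by decide
  have h := key (i % 72 / 6) (by omega) (j % 72 / 6) (by omega)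
  rw [show 6 * (i % 72 / 6) + 3 = i % 72 by omega, show 6 * (j % 72 / 6) + 3 = j % 72 by omega,
    show (2 * (i % 72) + j % 72) % 72 = (2 * i + j) % 72 by omega,
    show (i % 72 + 2 * (j % 72)) % 72 = (i + 2 * j) % 72 by omega,
    show i % 72 % 24 = i % 24 by omega, show j % 72 % 24 = j % 24 by omega] at h
  simp only [secondParityDegree_iff (show 3 < 2 * i + j by omega),
    secondParityDegree_iff (show 3 < i + 2 * j by omega)]
  exact h

/-- Here 9 divides 3i, and among the listed residues only 45 = 3·15 and 63 = 3·21 are multiples of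
9. -/
theorem secondParity_cube (i : ℕ) (hi : i % 6 = 3) :
    (if SecondParityDegree (3 * i) then 1 else 0 : ZMod 2) =
      if FirstParityDegree i then 1 else 0 := by
  simp only [FirstParityDegree, SecondParityDegree, Finset.mem_insert, Finset.mem_singleton]
  congr 1
  apply propext
  omega

end ParityFunctional

/-! ### The candidate subgroup and the reduction to cube closure -/

/-- The elements of `digitSumSubgroup` on which both parity sums vanish. -/
noncomputable def paritySubgroup : AddSubgroup ℤ[X] :=
  digitSumSubgroup ⊓ ((paritySum FirstParityDegree).ker ⊓ (paritySum SecondParityDegree).ker)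

theorem mem_paritySubgroup {p : ℤ[X]} : p ∈ paritySubgroup ↔
    p ∈ digitSumSubgroup ∧ paritySum FirstParityDegree p = 0 ∧
      paritySum SecondParityDegree p = 0 := Iff.rfl

/-- Both parity sums of the cube have the first parity sum of `p` as a factor. -/
theorem paritySubgroup_cubeClosed : paritySubgroup.CubeClosed := by
  rintro p ⟨hp, hp₁, -⟩
  have hq := map_mem_powSpan hp.1
  have hp₁ : paritySum FirstParityDegree p = 0 := hp₁
  rw [paritySum_apply] at hp₁
  refine mem_paritySubgroup.2 ⟨digitSumSubgroup_cubeClosed p hp, ?_, ?_⟩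
  · rw [paritySum_apply, Polynomial.map_pow,
      weightSum_cube firstParity_cross firstParity_cube hq, hp₁, zero_mul]
  · rw [paritySum_apply, Polynomial.map_pow,
      weightSum_cube secondParity_cross secondParity_cube hq, hp₁, zero_mul]

theorem X_pow_three_mem_paritySubgroup : (X ^ 3 : ℤ[X]) ∈ paritySubgroup := by
  have h : ∀ (P : ℕ → Prop) [DecidablePred P], ¬ P 3 → paritySum P (X ^ 3) = 0 := by
    intro P _ hP
    simpa [hP] using paritySum_C_mul_X_pow P 1 3
  refine mem_paritySubgroup.2 ⟨?_, h _ (by decide), h _ (by decide)⟩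
  simpa using C_mul_X_pow_mem_digitSumSubgroup (c := 1) (i := 3) rfl (by simp [digitSum])

theorem cubeClosure_X_pow_three_le : cubeClosure (X ^ 3 : ℤ[X]) ≤ paritySubgroup :=
  cubeClosure_le X_pow_three_mem_paritySubgroup paritySubgroup_cubeClosed

theorem mem_closure_X_pow_three_iff {p : ℤ[X]} :
    p ∈ Subnearring.closure ({X ^ 3} : Set ℤ[X]) ↔ p ∈ cubeClosure (X ^ 3 : ℤ[X]) := by
  constructor
  · intro h
    let N : Subnearring ℤ[X] :=
      { cubeClosure (X ^ 3 : ℤ[X]) with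
        circ_mem' := by
          intro a b ha hb
          -- Composition with `b` on the right is a ring homomorphism, so the preimage of a cube
          -- closed group is cube closed; it contains `X ^ 3` because b^3 lies in the closure.
          have hle : cubeClosure (X ^ 3 : ℤ[X]) ≤
              (cubeClosure (X ^ 3 : ℤ[X])).comap (compRingHom b).toAddMonoidHom := by
            refine cubeClosure_le ?_ fun f hf => ?_
            · have := cubeClosure_cubeClosed (X ^ 3 : ℤ[X]) b hb
              simpa [AddSubgroup.mem_comap] using this
            · have := cubeClosure_cubeClosed (X ^ 3 : ℤ[X]) _ (AddSubgroup.mem_comap.1 hf)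
              simpa [AddSubgroup.mem_comap] using this
          exact hle ha }
    exact h N (Set.singleton_subset_iff.2 (self_mem_cubeClosure _))
  · intro h S hS
    have hX : (X ^ 3 : ℤ[X]) ∈ S := hS rfl
    refine cubeClosure_le (S := S.toAddSubgroup) hX (fun a ha => ?_) h
    have := S.circ_mem' hX ha
    change (X ^ 3 : ℤ[X]).comp a ∈ S.carrier at this
    simpa using this

/-! ### Sufficiency of the conditions -/

section CubeClosed

variable {R : Type*} [CommRing R]

theorem AddSubgroup.CubeClosed.pow_three_pow_mem {S : AddSubgroup R} (hS : S.CubeClosed) {y : R}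
    (hy : y ∈ S) (j : ℕ) : y ^ 3 ^ j ∈ S := by
  induction j with
  | zero => simpa using hy
  | succ j ih =>
    rw [pow_succ, pow_mul]
    exact hS _ ih

/-- Splitting two powers of 3 off the exponent lowers its digit sum by 2 and costs one factor 6. -/
theorem AddSubgroup.CubeClosed.six_pow_mul_pow_mem {S : AddSubgroup R} (hS : S.CubeClosed) {y : R}
    (hy : y ∈ S) (t : ℕ) (ht : t % 2 = 1) : 6 ^ ((digitSum 3 t - 1) / 2) * y ^ t ∈ S := by
  induction t using Nat.strong_induction_on with
  | _ t ih =>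
    obtain ⟨m, j, htm, hs⟩ := exists_eq_add_three_pow (n := t) (by omega)
    rcases Nat.eq_zero_or_pos m with rfl | hm
    · have h0 : digitSum 3 0 = 0 := rfl
      rw [hs, h0, htm]
      simpa using hS.pow_three_pow_mem hy j
    · obtain ⟨l, k, hml, hs'⟩ := exists_eq_add_three_pow hm
      have hj : 3 ^ j % 2 = 1 := by simp [Nat.pow_mod]
      have hk : 3 ^ k % 2 = 1 := by simp [Nat.pow_mod]
      have hl := digitSum_three_mod_two l
      have hj' : 0 < 3 ^ j := by positivity
      have hk' : 0 < 3 ^ k := by positivity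
      have h := hS.six_mul_mem (ih l (by omega) (by omega)) (hS.pow_three_pow_mem hy k)
        (hS.pow_three_pow_mem hy j)
      convert h using 1
      rw [hs, hs', show (digitSum 3 l + 1 + 1 - 1) / 2 = (digitSum 3 l - 1) / 2 + 1 by omega,
        pow_succ, htm, hml, pow_add, pow_add]
      ring

end CubeClosed

theorem paritySum_eq_zero_of_mem_threeSaturation (P : ℕ → Prop) [DecidablePred P]
    {S : AddSubgroup ℤ[X]} (hS : S ≤ (paritySum P).ker) {f : ℤ[X]}
    (hf : f ∈ S.threeSaturation) : paritySum P f = 0 := by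
  obtain ⟨k, hk⟩ := hf
  have h : paritySum P (3 ^ k * f) = 0 := hS hk
  rw [show (3 : ℤ[X]) ^ k * f = (3 ^ k : ℕ) • f by rw [nsmul_eq_mul]; push_cast; rfl, map_nsmul,
    nsmul_eq_mul] at h
  have h3 : ((3 ^ k : ℕ) : ZMod 2) = 1 := by
    push_cast
    rw [show (3 : ZMod 2) = 1 from rfl, one_pow]
  rwa [h3, one_mul] at h

theorem paritySubgroup_le_threeSaturation :
    paritySubgroup ≤ (cubeClosure (X ^ 3 : ℤ[X])).threeSaturation := by
  intro p hp
  have hT := (cubeClosure_cubeClosed (X ^ 3 : ℤ[X])).cubeSaturated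
  have hker₁ : cubeClosure (X ^ 3 : ℤ[X]) ≤ (paritySum FirstParityDegree).ker := fun f hf =>
    (mem_paritySubgroup.1 (cubeClosure_X_pow_three_le hf)).2.1
  have hker₂ : cubeClosure (X ^ 3 : ℤ[X]) ≤ (paritySum SecondParityDegree).ker := fun f hf =>
    (mem_paritySubgroup.1 (cubeClosure_X_pow_three_le hf)).2.2
  set T := (cubeClosure (X ^ 3 : ℤ[X])).threeSaturation
  have hy : (X ^ 3 : ℤ[X]) ∈ T := AddSubgroup.le_threeSaturation _ (self_mem_cubeClosure _)
  obtain ⟨hp₀, hp₁, hp₂⟩ := mem_paritySubgroup.1 hp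
  have hmem : p ∈ T.adjoinPow (X ^ 3) := by
    refine digitSumSubgroup_induction (AddSubgroup.zero_mem _)
      (fun a _ b _ ha hb => AddSubgroup.add_mem _ ha hb) (fun c i hi _ => ?_) hp₀
    have h := AddSubgroup.intCast_mul_mem _ c
      (hT.pow_mem_adjoinPow_and_two_mul_pow_mem hy (i / 3) (Nat.odd_iff.2 (by omega))).1
    rw [← pow_mul, show 3 * (i / 3) = i by omega] at h
    simpa using h
  obtain ⟨α, β, h⟩ := AddSubgroup.mem_adjoinPow.1 hmem
  have hform : p + (α : ℤ[X]) * (X ^ 3) ^ 5 + (β : ℤ[X]) * (X ^ 3) ^ 11 =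
      p + C α * X ^ 15 + C β * X ^ 33 := by
    simp [← pow_mul]
  have e₁ := paritySum_eq_zero_of_mem_threeSaturation _ hker₁ h
  have e₂ := paritySum_eq_zero_of_mem_threeSaturation _ hker₂ h
  -- Degree 15 counts only in the first parity sum and degree 33 only in the second, so α and β are
  -- both even.
  rw [hform, map_add, map_add, paritySum_C_mul_X_pow, paritySum_C_mul_X_pow, hp₁,
    if_pos (by decide), if_neg (by decide), zero_add, add_zero,
    ZMod.intCast_zmod_eq_zero_iff_dvd] at e₁
  rw [hform, map_add, map_add, paritySum_C_mul_X_pow, paritySum_C_mul_X_pow, hp₂,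
    if_neg (by decide), if_pos (by decide), zero_add, zero_add,
    ZMod.intCast_zmod_eq_zero_iff_dvd] at e₂
  obtain ⟨a, rfl⟩ := e₁
  obtain ⟨b, rfl⟩ := e₂
  have h₅ := T.intCast_mul_mem a
    (hT.two_mul_small_pow_mem hy (n := 5) (by norm_num) (by decide))
  have h₁₁ := T.intCast_mul_mem b
    (hT.two_mul_small_pow_mem hy (n := 11) (by norm_num) (by decide))
  convert T.sub_mem (T.sub_mem h h₅) h₁₁ using 1
  push_cast
  ring

/-- Both 6^e X^i and 2·3^k X^i lie in the closure; a Bézout relation between 2^e and 3^k combines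
them into 2·3^e X^i. -/
theorem two_mul_mem_cubeClosure {p : ℤ[X]} (hp : p ∈ digitSumSubgroup) :
    2 * p ∈ cubeClosure (X ^ 3 : ℤ[X]) := by
  have hS := cubeClosure_cubeClosed (X ^ 3 : ℤ[X])
  have hX := self_mem_cubeClosure (X ^ 3 : ℤ[X])
  set S := cubeClosure (X ^ 3 : ℤ[X])
  refine digitSumSubgroup_induction (P := fun p => 2 * p ∈ S) (by simp)
    (fun a _ b _ ha hb => by rw [mul_add]; exact S.add_mem ha hb) (fun c i hi hc => ?_) hp
  obtain ⟨k, hk⟩ := (hS.cubeSaturated.pow_mem_adjoinPow_and_two_mul_pow_mem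
    (S.le_threeSaturation hX) (i / 3) (Nat.odd_iff.2 (by omega))).2
  have h6 := hS.six_pow_mul_pow_mem hX (i / 3) (by omega)
  rw [← digitSum_three_mul, ← pow_mul, show 3 * (i / 3) = i by omega] at h6
  rw [← pow_mul, show 3 * (i / 3) = i by omega] at hk
  obtain ⟨d, rfl⟩ := hc
  set e := (digitSum 3 i - 1) / 2
  have hcop : IsCoprime ((2 : ℤ) ^ e) (3 ^ k) :=
    IsCoprime.pow (by norm_num)
  obtain ⟨u, v, huv⟩ := hcop
  have h₁ := S.intCast_mul_mem (2 * d * u) h6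
  have h₂ := S.intCast_mul_mem (3 ^ e * d * v) hk
  convert S.add_mem h₁ h₂ using 1
  have huv' : (u : ℤ[X]) * 2 ^ e + v * 3 ^ k = 1 := by exact_mod_cast huv
  have h23 : (6 : ℤ[X]) ^ e = 2 ^ e * 3 ^ e := by rw [← mul_pow]; norm_num
  rw [h23]
  simp only [map_mul, map_pow, eq_intCast]
  push_cast
  linear_combination (-(2 * (d : ℤ[X]) * 3 ^ e * X ^ i)) * huv'

theorem cubeClosure_X_pow_three : cubeClosure (X ^ 3 : ℤ[X]) = paritySubgroup := by
  refine le_antisymm cubeClosure_X_pow_three_le fun p hp => ?_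
  obtain ⟨k, hk⟩ := paritySubgroup_le_threeSaturation hp
  have hodd : Odd (3 ^ k : ℤ) := Odd.pow (by decide)
  obtain ⟨m, hm⟩ := hodd
  have hm' : (3 : ℤ[X]) ^ k = 2 * m + 1 := by exact_mod_cast congrArg (Int.cast : ℤ → ℤ[X]) hm
  -- With 3^k = 2m + 1, p = 3^k p - m(2p).
  have h := AddSubgroup.sub_mem _ hk
    (AddSubgroup.intCast_mul_mem _ m (two_mul_mem_cubeClosure (mem_paritySubgroup.1 hp).1))
  convert h using 1
  rw [hm']
  ring

theorem theorem5p13 (p : ℤ[X]) :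
    p ∈ Subnearring.closure ({X ^ 3} : Set ℤ[X]) ↔
      (∀ i : ℕ, i % 6 ≠ 3 → p.coeff i = 0) ∧
      (∀ i : ℕ, i % 6 = 3 → (3 : ℤ) ^ ((digitSum 3 i - 1) / 2) ∣ p.coeff i) ∧
      (2 : ℤ) ∣ ∑ j ∈ p.support with j % 24 ∈ ({15, 21} : Finset ℕ), p.coeff j ∧
      (2 : ℤ) ∣ ∑ j ∈ p.support with
        j % 72 ∈ ({3, 33, 45, 51, 57, 63} : Finset ℕ) ∧ j ≠ 3, p.coeff j := by
  rw [mem_closure_X_pow_three_iff, cubeClosure_X_pow_three, mem_paritySubgroup,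
    mem_digitSumSubgroup, and_assoc, ← two_dvd_sum_iff, ← two_dvd_sum_iff]
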